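/- There is an absolute constant $K>0$ such that the following holds. Let $q\ge 1$ be an integer, let $A,D$ be finite-dimensional Hilbert spaces of arbitrary dimensions, let $B,C$ be qudits ($B=C=\mathbb C^q$), and let $|\psi\rangle\in A\otimes B\otimes C\otimes D$ be a unit vector. Let $u$ be a unitary on $B\otimes C$, with matrix entries $u_{ij,kl}$ (output indices $i,j$ and input indices $k,l$ of the first and second qudit), and let $|\psi'\rangle=(\mathbb I_A\otimes u\otimes \mathbb I_D)|\psi\rangle$, whose qudits are denoted $B',C'$. Write $S(\rho)=-\operatorname{tr}(\rho\ln\rho)$, $S(AB)=S(\operatorname{tr}_{CD}|\psi\rangle\langle\psi|)$ and $S(AB')=S(\operatorname{tr}_{C'D}|\psi'\rangle\langle\psi'|)$, and define $\epsilon\in\mathbb R$ by $$S(AB')-S(AB)=2\ln q-\epsilon .$$ Let $T_u$ be the operator on $\mathbb C^q\otimes\mathbb C^q$ obtained from $u$, $u^\dagger$ and Bell pairs by $$(T_u)_{ki,\,k'i'}=\sum_{j,l=1}^{q}u_{ij,kl}\,\overline{u_{i'j,k'l}} ,$$ so that $u$ is dual unitary if and only if $T_u=\mathbb I\otimes\mathbb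 I$. Then, with $\|X\|_1=\operatorname{tr}\sqrt{X^\dagger X}$, $$\Big\|\tfrac1q\mathbb I\otimes\tfrac1q\mathbb I-\tfrac1{q^2}T_u\Big\|_1\le K\,\epsilon^{1/2}.$$ (The hypotheses force $\epsilon\ge 0$. Thus $u$ is approximately dual unitary when $\epsilon$ is small.) -/

import Mathlib

noncomputable section

namespace DualUnitarity

/-- The von Neumann entropy `-tr (ρ ln ρ) = -∑ λ ln λ` of a Hermitian matrix, the sum running over
the eigenvalues of `ρ` with multiplicity. -/
def vonNeumannEntropy {n : Type*} [Fintype n] [DecidableEq n] {ρ : Matrix n n ℂ}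
    (hρ : ρ.IsHermitian) : ℝ :=
  ∑ i, Real.negMulLog (hρ.eigenvalues i)

/-- The trace norm `‖X‖₁ = tr √(X† X)`, that is, the sum of the singular values of `X`. -/
def traceNorm {n : Type*} [Fintype n] [DecidableEq n] (X : Matrix n n ℂ) : ℝ :=
  ∑ i, Real.sqrt ((Matrix.isHermitian_conjTranspose_mul_self X).eigenvalues i)

/-- The rank-one operator `|ψ⟩⟨ψ|`. -/
def pureDensity {n : Type*} (ψ : EuclideanSpace ℂ n) : Matrix n n ℂ :=
  Matrix.of fun x y => ψ x * star (ψ y)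

/-- The partial trace over the second tensor factor. -/
def partialTraceRight {l r : Type*} [Fintype r] (ρ : Matrix (l × r) (l × r) ℂ) : Matrix l l ℂ :=
  Matrix.of fun x y => ∑ k, ρ (x, k) (y, k)

theorem partialTraceRight_pureDensity_isHermitian {l r : Type*} [Fintype r]
    (ψ : EuclideanSpace ℂ (l × r)) : (partialTraceRight (pureDensity ψ)).IsHermitian := by
  ext x y
  simp [partialTraceRight, pureDensity, Matrix.conjTranspose_apply, mul_comm]

/-- The entropy of the first factor of a bipartite pure state, i.e. the von Neumann entropy of its
reduced density matrix on that factor. -/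
def entanglementEntropy {l r : Type*} [Fintype l] [DecidableEq l] [Fintype r]
    (ψ : EuclideanSpace ℂ (l × r)) : ℝ :=
  vonNeumannEntropy (partialTraceRight_pureDensity_isHermitian ψ)

/-- The vector `(1_A ⊗ u ⊗ 1_D) ψ` for a vector `ψ` on `A ⊗ B ⊗ C ⊗ D` (bracketed as
`(A ⊗ B) ⊗ (C ⊗ D)`) and a two-qudit gate `u` with matrix entries `u (b', c') (b, c)`, which maps
`B ⊗ C` to `B' ⊗ C'`. -/
def applyGate {q : ℕ} {A D : Type*} (u : Matrix (Fin q × Fin q) (Fin q × Fin q) ℂ)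
    (ψ : EuclideanSpace ℂ ((A × Fin q) × (Fin q × D))) :
    EuclideanSpace ℂ ((A × Fin q) × (Fin q × D)) :=
  WithLp.toLp 2 fun x =>
    ∑ b, ∑ c, u (x.1.2, x.2.1) (b, c) * ψ ((x.1.1, b), (c, x.2.2))

/-- The contraction of `u` and `u†` in the dual-unitarity condition, as an operator on the
input leg `k` (bent around by an unnormalised Bell pair `∑ k, |k k⟩`) and the output leg `i`:
`∑ j l, u_{i j, k l} * conj u_{i' j, k' l}` is the entry in row `(k, i)` and column `(k', i')`.
The gate `u` is dual unitary if and only if this is the identity matrix. -/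
def dualContraction {q : ℕ} (u : Matrix (Fin q × Fin q) (Fin q × Fin q) ℂ) :
    Matrix (Fin q × Fin q) (Fin q × Fin q) ℂ :=
  Matrix.of fun x y => ∑ j, ∑ l, u (x.2, j) (x.1, l) * star (u (y.2, j) (y.1, l))

/-- The maximally mixed state `1 / q` on one qudit. -/
def maximallyMixed (q : ℕ) : Matrix (Fin q) (Fin q) ℂ :=
  (q : ℂ)⁻¹ • (1 : Matrix (Fin q) (Fin q) ℂ)

end DualUnitarity

end

/-!
Write `S` for entropies of marginals of the state, primed systems being those after the gate. Since
the global state is pure, `ε = 2 ln q + S(AB) - S(AB')` splits in two ways,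
`[ln q + S(AB) - S(A)] + [ln q + S(A) - S(AB')]` and
`[ln q + S(AB) - S(D)] + [ln q + S(D) - S(AB')]`. Each bracket is the relative entropy of a state to
the product of a marginal with a maximally mixed qudit: of `BCD` to `1/q ⊗ ρ_CD`, of `AB'` to
`ρ_A ⊗ 1/q`, of `ABC` to `ρ_AB ⊗ 1/q`, and of `C'D` to `1/q ⊗ ρ_D`. So each of these relative
entropies lies between `0` and `ε` (`entropy_defects_le`).

Relative entropy dominates the squared Hilbert–Schmidt distance of square roots
(`hsSq_sqrt_sub_sqrt_le`). This is the only entropy inequality used, and it gives the rate `√ε`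
without loss: on the one hand it implies a Pinsker-type bound on the trace distance
(`norm_trace_sub_kronecker_maximallyMixed_le`), on the other hand it compares purifications. Namely,
the entropies involved depend only on `ρ_BCD`, so `A` may be replaced by a copy of `BCD` and the
state by the square root of `ρ_BCD`, regarded as a vector. That vector is `√ε`-close to the square
root of `1/q ⊗ ρ_CD`, in which `B` is maximally entangled with its copy `B̃`.

Now consider the state of `B̃B'`. As `AB'` is almost `ρ_A ⊗ 1/q` and `B̃` is almost maximally mixed,
it is within `4 √ε` of `1/q²`. As `C` is almost maximally mixed and decoupled from `AB`, and `B̃B`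
is almost maximally entangled, it is also within `4 √ε` of the marginal `T_u / q²` of the Choi state
of `u`. The last step of both comparisons is the same lemma, `norm_trace_choiVector_sub_le`, for the
swap gate (which is dual unitary) and for `u`. All distances are measured against one unitary that
attains the trace norm of `1/q² - T_u/q²`, so `K = 8`.
-/

noncomputable section

namespace DualUnitarity

open Matrix
open scoped Kronecker ComplexOrder

section Matrices

variable {l m n : Type*} [Fintype l] [Fintype m] [Fintype n]

/-! ### Spectral sums, entropy and trace norm -/

/-- The sum of `f` over the roots of the characteristic polynomial, with multiplicity. For a
Hermitian matrix this is the sum of `f` over its eigenvalues; phrasing it through `charpoly` makes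
it visibly invariant under transposition and under `X * Y ↦ Y * X`. -/
def spectralSum [DecidableEq n] (f : ℝ → ℝ) (X : Matrix n n ℂ) : ℝ :=
  (X.charpoly.roots.map fun z => f z.re).sum

theorem sum_eigenvalues_eq_spectralSum [DecidableEq n] (f : ℝ → ℝ) {X : Matrix n n ℂ}
    (hX : X.IsHermitian) : ∑ i, f (hX.eigenvalues i) = spectralSum f X := by
  simp [spectralSum, hX.roots_charpoly_eq_eigenvalues]

theorem spectralSum_transpose [DecidableEq n] (f : ℝ → ℝ) (X : Matrix n n ℂ) :
    spectralSum f Xᵀ = spectralSum f X := by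
  rw [spectralSum, spectralSum, charpoly_transpose]

theorem spectralSum_unitary_conj [DecidableEq n] (f : ℝ → ℝ) {U : Matrix n n ℂ}
    (hU : U ∈ unitaryGroup n ℂ) (p : n → ℝ) :
    spectralSum f (U * diagonal (fun i => (p i : ℂ)) * Uᴴ) = ∑ i, f (p i) := by
  have hU' : Uᴴ * U = 1 := mem_unitaryGroup_iff'.1 hU
  rw [spectralSum, charpoly_mul_comm, ← mul_assoc, hU', one_mul, charpoly_diagonal,
    Polynomial.roots_prod]
  · simp
  · simp [Finset.prod_ne_zero_iff, Polynomial.X_sub_C_ne_zero]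

/-- `X * Y` and `Y * X` have the same nonzero eigenvalues even when `X` and `Y` are rectangular,
and the superfluous zero eigenvalues do not contribute because `f 0 = 0`. -/
theorem spectralSum_mul_comm [DecidableEq m] [DecidableEq n] {f : ℝ → ℝ} (hf : f 0 = 0)
    (X : Matrix m n ℂ) (Y : Matrix n m ℂ) : spectralSum f (X * Y) = spectralSum f (Y * X) := by
  have h := congrArg (fun P : Polynomial ℂ => (P.roots.map fun z : ℂ => f z.re).sum)
    (charpoly_mul_comm' X Y)
  have h0 : ∀ (k : ℕ) {P : Polynomial ℂ}, P.Monic →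
      ((Polynomial.X ^ k * P).roots.map fun z : ℂ => f z.re).sum
        = (P.roots.map fun z : ℂ => f z.re).sum := by
    intro k P hP
    rw [Polynomial.roots_mul (((Polynomial.monic_X_pow k).mul hP).ne_zero)]
    simp [hf, Multiset.nsmul_singleton]
  simp only [h0 _ (charpoly_monic _)] at h
  exact h

theorem isHermitian_eq_unitary_conj_diagonal [DecidableEq n] {X : Matrix n n ℂ}
    (hX : X.IsHermitian) :
    X = (hX.eigenvectorUnitary : Matrix n n ℂ) * diagonal (fun i => (hX.eigenvalues i : ℂ))
      * (hX.eigenvectorUnitary : Matrix n n ℂ)ᴴ := by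
  conv_lhs => rw [hX.spectral_theorem, Unitary.conjStarAlgAut_apply]
  rfl

/-- The von Neumann entropy as a function of the matrix alone, without a proof of Hermiticity. -/
def entropy [DecidableEq n] (X : Matrix n n ℂ) : ℝ := spectralSum Real.negMulLog X

theorem vonNeumannEntropy_eq_entropy [DecidableEq n] {X : Matrix n n ℂ} (hX : X.IsHermitian) :
    vonNeumannEntropy hX = entropy X :=
  sum_eigenvalues_eq_spectralSum _ hX

theorem entropy_mul_conjTranspose [DecidableEq m] [DecidableEq n] (X : Matrix m n ℂ) :
    entropy (X * Xᴴ) = entropy (Xᴴ * X) :=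
  spectralSum_mul_comm Real.negMulLog_zero _ _

/-- The two marginals of a bipartite pure state with coefficient matrix `X` have the same
entropy. -/
theorem entropy_transpose_mul [DecidableEq m] [DecidableEq n] (X : Matrix m n ℂ) :
    entropy (Xᵀ * Xᵀᴴ) = entropy (X * Xᴴ) := by
  rw [entropy_mul_conjTranspose X, entropy, entropy, ← spectralSum_transpose _ (Xᴴ * X)]
  rw [transpose_mul]
  rfl

/-- The trace norm of a Hermitian matrix is attained on a unitary. -/
theorem exists_unitary_trace_mul_eq_traceNorm [DecidableEq n] {X : Matrix n n ℂ}
    (hX : X.IsHermitian) :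
    ∃ W ∈ unitaryGroup n ℂ, (W * X).trace = (traceNorm X : ℂ) := by
  set U : Matrix n n ℂ := (hX.eigenvectorUnitary : Matrix n n ℂ) with hUdef
  have hU : U ∈ unitaryGroup n ℂ := hX.eigenvectorUnitary.2
  have hU' : Uᴴ * U = 1 := mem_unitaryGroup_iff'.1 hU
  set s : n → ℝ := hX.eigenvalues
  have hXe : X = U * diagonal (fun i => (s i : ℂ)) * Uᴴ := isHermitian_eq_unitary_conj_diagonal hX
  -- The sign, with value `1` at `0` so that `W` is unitary.
  let g : n → ℂ := fun i => if 0 ≤ s i then 1 else -1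
  have hg : ∀ i, g i * s i = (|s i| : ℝ) := by
    intro i
    by_cases h : 0 ≤ s i
    · simp [g, h, abs_of_nonneg h]
    · simp [g, h, abs_of_neg (not_le.1 h)]
  have hgg : ∀ i, g i * star (g i) = 1 := by
    intro i
    by_cases h : 0 ≤ s i <;> simp [g, h]
  have hG : diagonal g ∈ unitaryGroup n ℂ := by
    rw [mem_unitaryGroup_iff, star_eq_conjTranspose, diagonal_conjTranspose, diagonal_mul_diagonal]
    simp only [Pi.star_apply, hgg]
    exact diagonal_one
  refine ⟨U * diagonal g * Uᴴ, mul_mem (mul_mem hU hG) (Unitary.star_mem hU), ?_⟩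
  have hsq : Xᴴ * X = U * diagonal (fun i => ((s i ^ 2 : ℝ) : ℂ)) * Uᴴ := by
    rw [hX.eq]
    conv_lhs => rw [hXe]
    calc _ = U * (diagonal (fun i => (s i : ℂ)) * (Uᴴ * U) * diagonal (fun i => (s i : ℂ)))
          * Uᴴ := by
          simp only [mul_assoc]
      _ = _ := by
          rw [hU', mul_one, diagonal_mul_diagonal]
          simp [sq]
  have hnorm : traceNorm X = ∑ i, |s i| := by
    rw [traceNorm, sum_eigenvalues_eq_spectralSum Real.sqrt, hsq, spectralSum_unitary_conj _ hU]
    simp [Real.sqrt_sq_eq_abs]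
  rw [hnorm]
  conv_lhs => rw [hXe]
  calc _ = (U * (diagonal g * (Uᴴ * U) * diagonal (fun i => (s i : ℂ))) * Uᴴ).trace := by
        simp only [mul_assoc]
    _ = _ := by
        rw [hU', mul_one, diagonal_mul_diagonal, trace_mul_comm, ← mul_assoc, hU', one_mul,
          trace_diagonal]
        simp [hg]

/-! ### The Hilbert–Schmidt norm -/

/-- The square of the Hilbert–Schmidt (Frobenius) norm. -/
def hsSq (X : Matrix m n ℂ) : ℝ := ∑ i, ∑ j, ‖X i j‖ ^ 2

theorem hsSq_nonneg (X : Matrix m n ℂ) : 0 ≤ hsSq X := by unfold hsSq; positivity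

theorem trace_mul_conjTranspose_self (X : Matrix m n ℂ) : (X * Xᴴ).trace = (hsSq X : ℂ) := by
  simp [trace, mul_apply, hsSq, Complex.mul_conj, Complex.normSq_eq_norm_sq]

theorem hsSq_conjTranspose (X : Matrix m n ℂ) : hsSq Xᴴ = hsSq X := by
  simp only [hsSq, conjTranspose_apply, norm_star]
  exact Finset.sum_comm

theorem hsSq_unitary_mul [DecidableEq m] {W : Matrix m m ℂ} (hW : W ∈ unitaryGroup m ℂ)
    (X : Matrix m n ℂ) : hsSq (W * X) = hsSq X := by
  have hW' : Wᴴ * W = 1 := mem_unitaryGroup_iff'.1 hW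
  have h := trace_mul_conjTranspose_self (W * X)
  rw [conjTranspose_mul, trace_mul_comm, Matrix.mul_assoc, ← Matrix.mul_assoc Wᴴ, hW',
    Matrix.one_mul, trace_mul_comm,
    trace_mul_conjTranspose_self] at h
  exact_mod_cast h.symm

theorem hsSq_mul_unitary [DecidableEq n] {W : Matrix n n ℂ} (hW : W ∈ unitaryGroup n ℂ)
    (X : Matrix m n ℂ) : hsSq (X * W) = hsSq X := by
  rw [← hsSq_conjTranspose, conjTranspose_mul, ← star_eq_conjTranspose W,
    hsSq_unitary_mul (Unitary.star_mem hW), hsSq_conjTranspose]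

/-- The Cauchy–Schwarz inequality for the Hilbert–Schmidt inner product. -/
theorem norm_trace_mul_conjTranspose_le (X Y : Matrix m n ℂ) :
    ‖(X * Yᴴ).trace‖ ≤ √(hsSq X) * √(hsSq Y) := by
  have h : (X * Yᴴ).trace = ∑ p : m × n, X p.1 p.2 * star (Y p.1 p.2) := by
    simp [trace, mul_apply, Fintype.sum_prod_type]
  rw [h]
  refine (norm_sum_le _ _).trans ?_
  simp only [norm_mul, norm_star, hsSq, ← Fintype.sum_prod_type']
  exact Real.sum_mul_le_sqrt_mul_sqrt _ _ _

/-- The states `X X†` and `Y Y†` are within trace distance `2 ‖X - Y‖₂`, tested against a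
unitary. -/
theorem norm_trace_unitary_sub_le [DecidableEq m] {W : Matrix m m ℂ} (hW : W ∈ unitaryGroup m ℂ)
    {X Y : Matrix m n ℂ} (hX : hsSq X = 1) (hY : hsSq Y = 1) :
    ‖(W * (X * Xᴴ)).trace - (W * (Y * Yᴴ)).trace‖ ≤ 2 * √(hsSq (X - Y)) := by
  have h : (W * (X * Xᴴ)).trace - (W * (Y * Yᴴ)).trace
      = ((W * (X - Y)) * Xᴴ).trace + ((W * Y) * (X - Y)ᴴ).trace := by
    rw [← trace_sub, ← trace_add, conjTranspose_sub]
    congr 1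
    simp only [Matrix.mul_sub, Matrix.sub_mul, Matrix.mul_assoc]
    abel
  rw [h]
  refine (norm_add_le _ _).trans ?_
  have h1 := norm_trace_mul_conjTranspose_le (W * (X - Y)) X
  have h2 := norm_trace_mul_conjTranspose_le (W * Y) (X - Y)
  rw [hsSq_unitary_mul hW, hX] at h1
  rw [hsSq_unitary_mul hW, hY] at h2
  simp only [Real.sqrt_one, mul_one, one_mul] at h1 h2
  linarith

/-! ### Relative entropy and square roots -/

theorem diag_unitary_conj_diagonal_eq_sum [DecidableEq n] (U V : Matrix n n ℂ) (p : n → ℝ) (j : n) :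
    (Vᴴ * (U * diagonal (fun i => (p i : ℂ)) * Uᴴ) * V) j j
      = ((∑ i, ‖(Uᴴ * V) i j‖ ^ 2 * p i : ℝ) : ℂ) := by
  have h : Vᴴ * (U * diagonal (fun i => (p i : ℂ)) * Uᴴ) * V
      = (Uᴴ * V)ᴴ * diagonal (fun i => (p i : ℂ)) * (Uᴴ * V) := by
    simp only [conjTranspose_mul, conjTranspose_conjTranspose, mul_assoc]
  rw [h, mul_apply]
  push_cast
  refine Finset.sum_congr rfl fun i _ => ?_
  rw [mul_diagonal, conjTranspose_apply, ← Complex.mul_conj']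
  simp only [RCLike.star_def]
  ring

theorem sum_norm_sq_row_of_unitary [DecidableEq n] {W : Matrix n n ℂ} (hW : W ∈ unitaryGroup n ℂ)
    (i : n) : ∑ j, ‖W i j‖ ^ 2 = 1 := by
  have h := congrFun (congrFun (mem_unitaryGroup_iff.1 hW) i) i
  simp only [mul_apply, star_apply, one_apply_eq, RCLike.star_def, Complex.mul_conj'] at h
  exact_mod_cast h

theorem sum_norm_sq_col_of_unitary [DecidableEq n] {W : Matrix n n ℂ} (hW : W ∈ unitaryGroup n ℂ)
    (j : n) : ∑ i, ‖W i j‖ ^ 2 = 1 := by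
  have h := sum_norm_sq_row_of_unitary (Unitary.star_mem hW) j
  simpa [star_apply] using h

theorem hsSq_unitary_conj_diagonal_sub [DecidableEq n] {U V : Matrix n n ℂ}
    (hU : U ∈ unitaryGroup n ℂ) (hV : V ∈ unitaryGroup n ℂ) (a b : n → ℝ) :
    hsSq (U * diagonal (fun i => (a i : ℂ)) * Uᴴ - V * diagonal (fun i => (b i : ℂ)) * Vᴴ)
      = ∑ i, ∑ j, ‖(Uᴴ * V) i j‖ ^ 2 * (a i - b j) ^ 2 := by
  have hU' : Uᴴ * U = 1 := mem_unitaryGroup_iff'.1 hU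
  have hV' : Vᴴ * V = 1 := mem_unitaryGroup_iff'.1 hV
  rw [← hsSq_mul_unitary hV, ← hsSq_unitary_mul (Unitary.star_mem hU), star_eq_conjTranspose]
  have h : Uᴴ * ((U * diagonal (fun i => (a i : ℂ)) * Uᴴ
        - V * diagonal (fun i => (b i : ℂ)) * Vᴴ) * V)
      = diagonal (fun i => (a i : ℂ)) * (Uᴴ * V) - (Uᴴ * V) * diagonal (fun i => (b i : ℂ)) := by
    calc _ = (Uᴴ * U) * diagonal (fun i => (a i : ℂ)) * (Uᴴ * V)
        - (Uᴴ * V) * diagonal (fun i => (b i : ℂ)) * (Vᴴ * V) := by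
          simp only [mul_sub, sub_mul, mul_assoc]
      _ = _ := by rw [hU', hV', one_mul, mul_one]
  rw [h, hsSq]
  refine Finset.sum_congr rfl fun i _ => Finset.sum_congr rfl fun j _ => ?_
  have e : (diagonal (fun i => (a i : ℂ)) * (Uᴴ * V)
      - (Uᴴ * V) * diagonal (fun i => (b i : ℂ))) i j = (Uᴴ * V) i j * ((a i - b j : ℝ) : ℂ) := by
    rw [Matrix.sub_apply, diagonal_mul, mul_diagonal]
    push_cast
    ring
  rw [e, norm_mul, mul_pow, Complex.norm_real, Real.norm_eq_abs, sq_abs]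

/-- The classical pointwise bound behind `hsSq_sqrt_sub_sqrt_le`, from `log x ≤ x - 1` at
`x = √(t / p)`. -/
theorem sq_sqrt_sub_sqrt_le {p t : ℝ} (hp : 0 ≤ p) (ht : 0 ≤ t) (h : t = 0 → p = 0) :
    (√p - √t) ^ 2 ≤ p * (Real.log p - Real.log t) - p + t := by
  rcases hp.eq_or_lt with rfl | hp
  · simp [Real.sq_sqrt ht]
  · have ht : 0 < t := lt_of_le_of_ne ht fun h' => hp.ne' (h h'.symm)
    have hlog := Real.log_le_sub_one_of_pos (div_pos (Real.sqrt_pos.2 ht) (Real.sqrt_pos.2 hp))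
    rw [Real.log_div (Real.sqrt_pos.2 ht).ne' (Real.sqrt_pos.2 hp).ne', Real.log_sqrt ht.le,
      Real.log_sqrt hp.le] at hlog
    have hd : p * (√t / √p) = √p * √t := by
      have : √p ≠ 0 := (Real.sqrt_pos.2 hp).ne'
      field_simp
      rw [Real.sq_sqrt hp.le]
    have := mul_le_mul_of_nonneg_left hlog hp.le
    nlinarith [Real.sq_sqrt hp.le, Real.sq_sqrt ht.le]

/-- `‖√ρ - √σ‖₂² ≤ tr ρ (ln ρ - ln σ)` for `ρ = U diag(p) U†` and `σ = V diag(t) V†` of equal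
trace, where `ρ` has no weight on the kernel of `σ`. In the two eigenbases the relative entropy is
that of the classical distributions `|W i j|² p i` and `|W i j|² t j` with `W = U† V`; the matrix
of the `|W i j|²` is doubly stochastic. -/
theorem hsSq_sqrt_sub_sqrt_le [DecidableEq n] {U V : Matrix n n ℂ}
    (hU : U ∈ unitaryGroup n ℂ) (hV : V ∈ unitaryGroup n ℂ) {p t : n → ℝ}
    (hp : ∀ i, 0 ≤ p i) (ht : ∀ j, 0 ≤ t j) (hsum : ∑ i, p i = ∑ j, t j)
    (hsupp : ∀ j, t j = 0 →
      (Vᴴ * (U * diagonal (fun i => (p i : ℂ)) * Uᴴ) * V) j j = 0) :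
    hsSq (U * diagonal (fun i => (√(p i) : ℂ)) * Uᴴ
        - V * diagonal (fun i => (√(t i) : ℂ)) * Vᴴ)
      ≤ ∑ i, p i * Real.log (p i) - ∑ j,
        ((Vᴴ * (U * diagonal (fun i => (p i : ℂ)) * Uᴴ) * V) j j).re * Real.log (t j) := by
  have hW : Uᴴ * V ∈ unitaryGroup n ℂ := mul_mem (Unitary.star_mem hU) hV
  set W := Uᴴ * V with hWdef
  have hdiag := diag_unitary_conj_diagonal_eq_sum U V p
  rw [← hWdef] at hdiag
  rw [hsSq_unitary_conj_diagonal_sub hU hV]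
  simp only [hdiag, Complex.ofReal_re] at hsupp ⊢
  rw [← hWdef]
  have h1 : ∑ i, ∑ j, ‖W i j‖ ^ 2 * (√(p i) - √(t j)) ^ 2
      ≤ ∑ i, ∑ j, ‖W i j‖ ^ 2 * (p i * (Real.log (p i) - Real.log (t j)) - p i + t j) := by
    refine Finset.sum_le_sum fun i _ => Finset.sum_le_sum fun j _ => ?_
    by_cases hz : t j = 0 → p i = 0
    · exact mul_le_mul_of_nonneg_left (sq_sqrt_sub_sqrt_le (hp i) (ht j) hz) (by positivity)
    -- The logarithm `log (t j)` is a junk value here, but its weight vanishes.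
    · push Not at hz
      have h0 := hsupp j hz.1
      have h0 : ∑ i, ‖W i j‖ ^ 2 * p i = 0 := by exact_mod_cast h0
      rw [Finset.sum_eq_zero_iff_of_nonneg fun i _ => mul_nonneg (by positivity) (hp i)] at h0
      have := (mul_eq_zero.1 (h0 i (Finset.mem_univ i))).resolve_right hz.2
      simp [this]
  refine h1.trans_eq ?_
  have hP : ∀ f : n → ℝ, ∑ i, ∑ j, ‖W i j‖ ^ 2 * f i = ∑ i, f i := by
    intro f
    simp [← Finset.sum_mul, sum_norm_sq_row_of_unitary hW]
  have hT : ∀ f : n → ℝ, ∑ i, ∑ j, ‖W i j‖ ^ 2 * f j = ∑ j, f j := by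
    intro f
    rw [Finset.sum_comm]
    simp [← Finset.sum_mul, sum_norm_sq_col_of_unitary hW]
  have hPT : ∑ i, ∑ j, ‖W i j‖ ^ 2 * (p i * Real.log (t j))
      = ∑ j, (∑ i, ‖W i j‖ ^ 2 * p i) * Real.log (t j) := by
    rw [Finset.sum_comm]
    simp only [Finset.sum_mul, mul_assoc]
  have := hP p
  have := hP fun i => p i * Real.log (p i)
  have := hT t
  calc _ = ∑ i, ∑ j, ‖W i j‖ ^ 2 * (p i * Real.log (p i))
        - ∑ i, ∑ j, ‖W i j‖ ^ 2 * (p i * Real.log (t j))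
        - ∑ i, ∑ j, ‖W i j‖ ^ 2 * p i + ∑ i, ∑ j, ‖W i j‖ ^ 2 * t j := by
        simp only [← Finset.sum_sub_distrib, ← Finset.sum_add_distrib]
        refine Finset.sum_congr rfl fun i _ => Finset.sum_congr rfl fun j _ => ?_
        ring
    _ = _ := by linarith

/-! ### Decoupling from a maximally mixed qudit -/

theorem partialTraceRight_kronecker_mul_mul [DecidableEq n] (A B : Matrix m m ℂ)
    (ρ : Matrix (m × n) (m × n) ℂ) :
    partialTraceRight ((A ⊗ₖ (1 : Matrix n n ℂ)) * ρ * (B ⊗ₖ (1 : Matrix n n ℂ)))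
      = A * partialTraceRight ρ * B := by
  ext x y
  simp only [partialTraceRight, of_apply, mul_apply, kroneckerMap_apply, Fintype.sum_prod_type,
    one_apply, mul_ite, ite_mul, mul_one, mul_zero, zero_mul, Finset.sum_ite_eq,
    Finset.sum_ite_eq', Finset.mem_univ, if_true, Finset.sum_mul, Finset.mul_sum]
  rw [Finset.sum_comm]
  refine Finset.sum_congr rfl fun i _ => ?_
  rw [Finset.sum_comm]

theorem posSemidef_partialTraceRight {m : Type*} {ρ : Matrix (m × n) (m × n) ℂ}
    (hρ : ρ.PosSemidef) : (partialTraceRight ρ).PosSemidef := by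
  have h : partialTraceRight ρ
      = ∑ k, ρ.submatrix (fun x => (x, k)) (fun x => (x, k)) := by
    ext x y
    simp [partialTraceRight, Matrix.sum_apply]
  rw [h]
  exact posSemidef_sum _ fun k _ => hρ.submatrix _

theorem trace_partialTraceRight (ρ : Matrix (m × n) (m × n) ℂ) :
    (partialTraceRight ρ).trace = ρ.trace := by
  simp [trace, partialTraceRight, Fintype.sum_prod_type]

/-- The relative entropy of `ρ` to `tr₂ ρ ⊗ 1 / q` equals `ln q + S(tr₂ ρ) - S(ρ)`; it bounds the
squared Hilbert–Schmidt distance between the square roots `R` of `ρ` and `S ⊗ 1 / √q` of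
`tr₂ ρ ⊗ 1 / q`. -/
theorem exists_sqrt_and_hsSq_le [DecidableEq m] {q : ℕ} (hq : 0 < q)
    {ρ : Matrix (m × Fin q) (m × Fin q) ℂ} (hρ : ρ.PosSemidef) (htr : ρ.trace = 1) :
    ∃ (R : Matrix (m × Fin q) (m × Fin q) ℂ) (S : Matrix m m ℂ),
      R * Rᴴ = ρ ∧ S * Sᴴ = partialTraceRight ρ ∧
      hsSq (R - ((√q)⁻¹ : ℂ) • S ⊗ₖ (1 : Matrix (Fin q) (Fin q) ℂ))
        ≤ Real.log q + entropy (partialTraceRight ρ) - entropy ρ := by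
  have hσ := posSemidef_partialTraceRight hρ
  set σ := partialTraceRight ρ with hσdef
  set U : Matrix (m × Fin q) (m × Fin q) ℂ :=
    (hρ.1.eigenvectorUnitary : Matrix (m × Fin q) (m × Fin q) ℂ)
  have hU : U ∈ unitaryGroup _ ℂ := hρ.1.eigenvectorUnitary.2
  set V : Matrix m m ℂ := (hσ.1.eigenvectorUnitary : Matrix m m ℂ)
  have hV : V ∈ unitaryGroup _ ℂ := hσ.1.eigenvectorUnitary.2
  set p := hρ.1.eigenvalues with hpdef
  set s := hσ.1.eigenvalues with hsdef
  have hp : ∀ i, 0 ≤ p i := hρ.eigenvalues_nonneg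
  have hs : ∀ i, 0 ≤ s i := hσ.eigenvalues_nonneg
  have hρe : ρ = U * diagonal (fun i => (p i : ℂ)) * Uᴴ :=
    isHermitian_eq_unitary_conj_diagonal hρ.1
  have hσe : σ = V * diagonal (fun i => (s i : ℂ)) * Vᴴ :=
    isHermitian_eq_unitary_conj_diagonal hσ.1
  have hUU : Uᴴ * U = 1 := mem_unitaryGroup_iff'.1 hU
  have hVV : Vᴴ * V = 1 := mem_unitaryGroup_iff'.1 hV
  have hq0 : (0 : ℝ) < q := by exact_mod_cast hq
  have hpsum : ∑ i, p i = 1 := by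
    have : (1 : ℂ) = ∑ i, (p i : ℂ) := htr.symm.trans hρ.1.trace_eq_sum_eigenvalues
    exact_mod_cast this.symm
  have hssum : ∑ i, s i = 1 := by
    have : (1 : ℂ) = ∑ i, (s i : ℂ) :=
      ((trace_partialTraceRight ρ).trans htr).symm.trans hσ.1.trace_eq_sum_eigenvalues
    exact_mod_cast this.symm
  have sqrt_mul : ∀ {k : Type _} [Fintype k] [DecidableEq k] (Y : Matrix k k ℂ) (r : k → ℝ),
      (∀ i, 0 ≤ r i) → Yᴴ * Y = 1 →
      (Y * diagonal (fun i => (√(r i) : ℂ)) * Yᴴ) * (Y * diagonal (fun i => (√(r i) : ℂ)) * Yᴴ)ᴴ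
        = Y * diagonal (fun i => (r i : ℂ)) * Yᴴ := by
    intro k _ _ Y r hr hY
    have hd : (diagonal (fun i => (√(r i) : ℂ)))ᴴ = diagonal (fun i => (√(r i) : ℂ)) := by
      rw [diagonal_conjTranspose]
      congr 1
      ext i
      simp
    calc _ = Y * (diagonal (fun i => (√(r i) : ℂ)) * (Yᴴ * Y) * diagonal (fun i => (√(r i) : ℂ)))
          * Yᴴ := by
          simp only [conjTranspose_mul, conjTranspose_conjTranspose, hd, mul_assoc]
      _ = _ := by
          rw [hY, mul_one, diagonal_mul_diagonal]
          congr 3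
          ext i
          rw [← Complex.ofReal_mul, Real.mul_self_sqrt (hr i)]
  refine ⟨U * diagonal (fun i => (√(p i) : ℂ)) * Uᴴ, V * diagonal (fun i => (√(s i) : ℂ)) * Vᴴ,
    by rw [hρe]; exact sqrt_mul U p hp hUU, by rw [hσe]; exact sqrt_mul V s hs hVV, ?_⟩
  have hV1 : V ⊗ₖ (1 : Matrix (Fin q) (Fin q) ℂ) ∈ unitaryGroup (m × Fin q) ℂ :=
    kronecker_mem_unitary hV (one_mem _)
  set V' := V ⊗ₖ (1 : Matrix (Fin q) (Fin q) ℂ) with hV'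
  have hV'H : V'ᴴ = Vᴴ ⊗ₖ (1 : Matrix (Fin q) (Fin q) ℂ) := by
    rw [hV', conjTranspose_kronecker, conjTranspose_one]
  have hR0 : ((√q)⁻¹ : ℂ) • (V * diagonal (fun i => (√(s i) : ℂ)) * Vᴴ)
        ⊗ₖ (1 : Matrix (Fin q) (Fin q) ℂ)
      = V' * diagonal (fun i : m × Fin q => (√(s i.1 / q) : ℂ)) * V'ᴴ := by
    have hd : diagonal (fun i : m × Fin q => (√(s i.1 / q) : ℂ))
        = ((√q)⁻¹ : ℂ) • (diagonal (fun i => (√(s i) : ℂ)) ⊗ₖ (1 : Matrix (Fin q) (Fin q) ℂ)) := by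
      rw [← diagonal_one, diagonal_kronecker_diagonal, ← diagonal_smul]
      congr 1
      ext i
      simp [div_eq_inv_mul]
    rw [hd, hV'H, hV', mul_smul_comm, smul_mul_assoc, ← mul_kronecker_mul, ← mul_kronecker_mul,
      one_mul, one_mul]
  have hptr : ∀ a, ∑ k, (V'ᴴ * ρ * V') (a, k) (a, k) = (s a : ℂ) := by
    intro a
    have h := congrFun (congrFun (partialTraceRight_kronecker_mul_mul (n := Fin q) Vᴴ V ρ) a) a
    rw [← hV'H, ← hV', ← hσdef, hσe] at h
    have e : Vᴴ * (V * diagonal (fun i => (s i : ℂ)) * Vᴴ) * V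
        = diagonal (fun i => (s i : ℂ)) := by
      calc _ = (Vᴴ * V) * diagonal (fun i => (s i : ℂ)) * (Vᴴ * V) := by simp only [mul_assoc]
        _ = _ := by rw [hVV, one_mul, mul_one]
    rw [e, diagonal_apply_eq] at h
    exact h
  have hdiag := diag_unitary_conj_diagonal_eq_sum U V' p
  rw [← hρe] at hdiag
  have hnn : ∀ j, 0 ≤ ∑ i, ‖(Uᴴ * V') i j‖ ^ 2 * p i :=
    fun j => Finset.sum_nonneg fun i _ => mul_nonneg (by positivity) (hp i)
  have hptr' : ∀ a, ∑ k, ∑ i, ‖(Uᴴ * V') i (a, k)‖ ^ 2 * p i = s a := by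
    intro a
    have h := (Finset.sum_congr rfl fun k _ => (hdiag (a, k)).symm).trans (hptr a)
    exact_mod_cast h
  have key := hsSq_sqrt_sub_sqrt_le hU hV1 (p := p) (t := fun i : m × Fin q => s i.1 / q) hp
    (fun j => div_nonneg (hs _) hq0.le)
    (by
      rw [hpsum, ← hssum, Fintype.sum_prod_type]
      simp only [Finset.sum_const, Finset.card_univ, Fintype.card_fin, nsmul_eq_mul]
      exact Finset.sum_congr rfl fun i _ => by field_simp)
    (by
      rintro ⟨a, k⟩ h0
      rw [← hρe, hdiag]
      have h0 : s a = 0 := by simpa [hq0.ne'] using h0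
      have h1 := hptr' a
      rw [h0, Finset.sum_eq_zero_iff_of_nonneg fun k _ => hnn (a, k)] at h1
      rw [h1 k (Finset.mem_univ k), Complex.ofReal_zero])
  rw [hR0]
  refine key.trans_eq ?_
  rw [← hρe]
  simp only [hdiag, Complex.ofReal_re, Fintype.sum_prod_type (f := fun j : m × Fin q =>
    (∑ i, ‖(Uᴴ * V') i j‖ ^ 2 * p i) * Real.log (s j.1 / q))]
  simp only [← Finset.sum_mul, hptr']
  have hlog : ∀ a, s a * Real.log (s a / q) = s a * Real.log (s a) - s a * Real.log q := by
    intro a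
    rcases eq_or_ne (s a) 0 with h | h
    · simp [h]
    · rw [Real.log_div h hq0.ne', mul_sub]
  rw [← vonNeumannEntropy_eq_entropy hσ.1, ← vonNeumannEntropy_eq_entropy hρ.1, vonNeumannEntropy,
    vonNeumannEntropy, ← hpdef, ← hsdef]
  simp only [hlog, Finset.sum_sub_distrib, ← Finset.sum_mul, hssum, Real.negMulLog, neg_mul,
    Finset.sum_neg_distrib]
  ring

theorem hsSq_eq_one_of_trace {X : Matrix m n ℂ} (h : (X * Xᴴ).trace = 1) : hsSq X = 1 := by
  rw [trace_mul_conjTranspose_self] at h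
  exact_mod_cast h

theorem conditional_entropy_defect_nonneg [DecidableEq m] {q : ℕ} (hq : 0 < q)
    {ρ : Matrix (m × Fin q) (m × Fin q) ℂ} (hρ : ρ.PosSemidef) (htr : ρ.trace = 1) :
    0 ≤ Real.log q + entropy (partialTraceRight ρ) - entropy ρ := by
  obtain ⟨R, S, -, -, h⟩ := exists_sqrt_and_hsSq_le hq hρ htr
  exact (hsSq_nonneg _).trans h

theorem smul_kronecker_one_mul_conjTranspose {m : Type*} {q : ℕ} (S : Matrix m n ℂ) :
    (((√q)⁻¹ : ℂ) • S ⊗ₖ (1 : Matrix (Fin q) (Fin q) ℂ))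
        * (((√q)⁻¹ : ℂ) • S ⊗ₖ (1 : Matrix (Fin q) (Fin q) ℂ))ᴴ
      = (S * Sᴴ) ⊗ₖ maximallyMixed q := by
  rw [conjTranspose_smul, conjTranspose_kronecker, conjTranspose_one, Matrix.smul_mul,
    Matrix.mul_smul, smul_smul, ← mul_kronecker_mul, Matrix.one_mul, maximallyMixed, kronecker_smul]
  congr 1
  rw [star_inv₀, RCLike.star_def, Complex.conj_ofReal, ← mul_inv, ← Complex.ofReal_mul,
    Real.mul_self_sqrt (Nat.cast_nonneg q), Complex.ofReal_natCast]

theorem trace_maximallyMixed {q : ℕ} (hq : 0 < q) : (maximallyMixed q).trace = 1 := by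
  have : (q : ℂ) ≠ 0 := by exact_mod_cast hq.ne'
  simp [maximallyMixed, trace_smul, this]

theorem hsSq_smul_kronecker_one {q : ℕ} (hq : 0 < q) (S : Matrix m n ℂ) :
    hsSq (((√q)⁻¹ : ℂ) • S ⊗ₖ (1 : Matrix (Fin q) (Fin q) ℂ)) = hsSq S := by
  have h := trace_mul_conjTranspose_self (((√q)⁻¹ : ℂ) • S ⊗ₖ (1 : Matrix (Fin q) (Fin q) ℂ))
  rw [smul_kronecker_one_mul_conjTranspose, trace_kronecker, trace_maximallyMixed hq,
    trace_mul_conjTranspose_self, mul_one] at h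
  exact_mod_cast h.symm

/-- A Pinsker-type inequality: the conditional entropy defect controls the trace distance between
`ρ` and `tr₂ ρ ⊗ 1 / q`, here tested against a unitary `Y`. -/
theorem norm_trace_sub_kronecker_maximallyMixed_le [DecidableEq m] {q : ℕ} (hq : 0 < q)
    {ρ : Matrix (m × Fin q) (m × Fin q) ℂ} (hρ : ρ.PosSemidef) (htr : ρ.trace = 1)
    {Y : Matrix (m × Fin q) (m × Fin q) ℂ} (hY : Y ∈ unitaryGroup (m × Fin q) ℂ) :
    ‖(Y * ρ).trace - (Y * partialTraceRight ρ ⊗ₖ maximallyMixed q).trace‖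
      ≤ 2 * √(Real.log q + entropy (partialTraceRight ρ) - entropy ρ) := by
  obtain ⟨R, S, hR, hS, h⟩ := exists_sqrt_and_hsSq_le hq hρ htr
  have hR1 : hsSq R = 1 := hsSq_eq_one_of_trace (by rw [hR, htr])
  have hS1 : hsSq S = 1 := hsSq_eq_one_of_trace (by rw [hS, trace_partialTraceRight, htr])
  have := norm_trace_unitary_sub_le hY hR1 ((hsSq_smul_kronecker_one hq S).trans hS1)
  rw [smul_kronecker_one_mul_conjTranspose, hR, hS] at this
  exact this.trans (by gcongr)

end Matrices

section States

variable {A D F : Type*} [Fintype A] [Fintype D] [Fintype F]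
variable {q : ℕ}

/-! ### Entropies of four-partite pure states -/

/-- `applyGate` for a state on `(A ⊗ B) ⊗ (C ⊗ D)` given by its coefficient matrix with rows
`A × B` and columns `C × D`. -/
def applyGateMatrix (u : Matrix (Fin q × Fin q) (Fin q × Fin q) ℂ) {A D : Type*}
    (Ψ : Matrix (A × Fin q) (Fin q × D) ℂ) : Matrix (A × Fin q) (Fin q × D) ℂ :=
  of fun x y => ∑ b, ∑ c, u (x.2, y.1) (b, c) * Ψ (x.1, b) (c, y.2)

/-- The coefficients of a state on `(A ⊗ B) ⊗ F` rearranged along the cut `(F ⊗ B) | A`. -/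
def cutA {A F : Type*} (Ψ : Matrix (A × Fin q) F ℂ) : Matrix (F × Fin q) A ℂ :=
  of fun x a => Ψ (a, x.2) x.1

/-- The coefficients of a state on `E ⊗ (C ⊗ D)` rearranged along the cut `(E ⊗ C) | D`. -/
def cutD {E D : Type*} (Ψ : Matrix E (Fin q × D) ℂ) : Matrix (E × Fin q) D ℂ :=
  of fun x d => Ψ x.1 (x.2, d)

/-- The coefficients of a state on `E ⊗ (C ⊗ D)` rearranged along the cut `(D ⊗ C) | E`. -/
def swapTranspose {E D : Type*} (Ψ : Matrix E (Fin q × D) ℂ) : Matrix (D × Fin q) E ℂ :=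
  of fun x e => Ψ e (x.2, x.1)

theorem partialTraceRight_cutA {F : Type*} (Ψ : Matrix (A × Fin q) F ℂ) :
    partialTraceRight (cutA Ψ * (cutA Ψ)ᴴ) = Ψᵀ * Ψᵀᴴ := by
  ext x y
  simp only [partialTraceRight, cutA, of_apply, mul_apply, conjTranspose_apply, transpose_apply,
    Fintype.sum_prod_type]
  exact Finset.sum_comm

theorem partialTraceRight_mul_conjTranspose {A E : Type*} [Fintype E] (Ψ : Matrix (A × Fin q) E ℂ) :
    partialTraceRight (Ψ * Ψᴴ) = (cutA Ψ)ᵀ * (cutA Ψ)ᵀᴴ := by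
  ext x y
  simp only [partialTraceRight, cutA, of_apply, mul_apply, conjTranspose_apply, transpose_apply,
    Fintype.sum_prod_type]
  exact Finset.sum_comm

theorem partialTraceRight_cutD {E : Type*} (Ψ : Matrix E (Fin q × D) ℂ) :
    partialTraceRight (cutD Ψ * (cutD Ψ)ᴴ) = Ψ * Ψᴴ := by
  ext x y
  simp only [partialTraceRight, cutD, of_apply, mul_apply, conjTranspose_apply,
    Fintype.sum_prod_type]

theorem partialTraceRight_swapTranspose {D E : Type*} [Fintype E] (Ψ : Matrix E (Fin q × D) ℂ) :
    partialTraceRight (swapTranspose Ψ * (swapTranspose Ψ)ᴴ) = (cutD Ψ)ᵀ * (cutD Ψ)ᵀᴴ := by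
  ext x y
  simp only [partialTraceRight, cutD, swapTranspose, of_apply, mul_apply, conjTranspose_apply,
    transpose_apply, Fintype.sum_prod_type]
  exact Finset.sum_comm

theorem swapTranspose_transpose_mul {E : Type*} [Fintype E] (Ψ : Matrix E (Fin q × D) ℂ) :
    (swapTranspose Ψ)ᵀ * (swapTranspose Ψ)ᵀᴴ = Ψ * Ψᴴ := by
  ext x y
  simp only [swapTranspose, of_apply, mul_apply, conjTranspose_apply, transpose_apply,
    Fintype.sum_prod_type]
  exact Finset.sum_comm

theorem submatrix_equiv_mem_unitaryGroup {m n : Type*} [Fintype m] [DecidableEq m] [Fintype n]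
    [DecidableEq n] {W : Matrix m m ℂ} (hW : W ∈ unitaryGroup m ℂ) (e : n ≃ m) :
    W.submatrix e e ∈ unitaryGroup n ℂ := by
  rw [mem_unitaryGroup_iff, star_eq_conjTranspose, conjTranspose_submatrix, submatrix_mul_equiv,
    ← star_eq_conjTranspose, mem_unitaryGroup_iff.1 hW, submatrix_one_equiv]

/-- The operator `1_A ⊗ u` on `(A ⊗ B) ⊗ C`. -/
def gateOnLeft (A : Type*) [DecidableEq A] (u : Matrix (Fin q × Fin q) (Fin q × Fin q) ℂ) :
    Matrix ((A × Fin q) × Fin q) ((A × Fin q) × Fin q) ℂ :=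
  ((1 : Matrix A A ℂ) ⊗ₖ u).submatrix (Equiv.prodAssoc _ _ _) (Equiv.prodAssoc _ _ _)

theorem gateOnLeft_mem_unitaryGroup [DecidableEq A]
    {u : Matrix (Fin q × Fin q) (Fin q × Fin q) ℂ} (hu : u ∈ unitaryGroup (Fin q × Fin q) ℂ) :
    gateOnLeft A u ∈ unitaryGroup ((A × Fin q) × Fin q) ℂ :=
  submatrix_equiv_mem_unitaryGroup (kronecker_mem_unitary (one_mem _) hu) _

theorem gateOnLeft_mul_apply [DecidableEq A] {E : Type*}
    (u : Matrix (Fin q × Fin q) (Fin q × Fin q) ℂ) (X : Matrix ((A × Fin q) × Fin q) E ℂ)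
    (a : A) (i j : Fin q) (y : E) :
    (gateOnLeft A u * X) ((a, i), j) y = ∑ b, ∑ c, u (i, j) (b, c) * X ((a, b), c) y := by
  simp [gateOnLeft, mul_apply, Fintype.sum_prod_type, one_apply]

theorem cutD_applyGateMatrix {D : Type*} [DecidableEq A]
    (u : Matrix (Fin q × Fin q) (Fin q × Fin q) ℂ)
    (Ψ : Matrix (A × Fin q) (Fin q × D) ℂ) :
    cutD (applyGateMatrix u Ψ) = gateOnLeft A u * cutD Ψ := by
  ext ⟨⟨a, i⟩, j⟩ d
  rw [gateOnLeft_mul_apply]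
  rfl

/-- The operator `u ⊗ 1_D` on `(C ⊗ D) ⊗ B`, where `u` takes `B` as its first and `C` as its second
qudit. -/
def gateOnRight (D : Type*) [DecidableEq D] (u : Matrix (Fin q × Fin q) (Fin q × Fin q) ℂ) :
    Matrix ((Fin q × D) × Fin q) ((Fin q × D) × Fin q) ℂ :=
  (u ⊗ₖ (1 : Matrix D D ℂ)).submatrix
    ((Equiv.prodComm _ _).trans (Equiv.prodAssoc _ _ _).symm)
    ((Equiv.prodComm _ _).trans (Equiv.prodAssoc _ _ _).symm)

theorem gateOnRight_mem_unitaryGroup [DecidableEq D]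
    {u : Matrix (Fin q × Fin q) (Fin q × Fin q) ℂ} (hu : u ∈ unitaryGroup (Fin q × Fin q) ℂ) :
    gateOnRight D u ∈ unitaryGroup ((Fin q × D) × Fin q) ℂ :=
  submatrix_equiv_mem_unitaryGroup (kronecker_mem_unitary hu (one_mem _)) _

theorem cutA_applyGateMatrix {A : Type*} [DecidableEq D]
    (u : Matrix (Fin q × Fin q) (Fin q × Fin q) ℂ)
    (Ψ : Matrix (A × Fin q) (Fin q × D) ℂ) :
    cutA (applyGateMatrix u Ψ) = gateOnRight D u * cutA Ψ := by
  ext ⟨⟨j, d⟩, i⟩ a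
  simp only [cutA, applyGateMatrix, of_apply, gateOnRight, mul_apply, submatrix_apply,
    Fintype.sum_prod_type, Equiv.trans_apply, Equiv.prodComm_apply, Prod.swap_prod_mk,
    Equiv.prodAssoc_symm_apply, kroneckerMap_apply, one_apply, mul_ite, mul_one, mul_zero, ite_mul,
    zero_mul]
  rw [Finset.sum_comm]
  refine Finset.sum_congr rfl fun c _ => ?_
  rw [Finset.sum_comm]
  simp

theorem entropy_unitary_mul {m n : Type*} [Fintype m] [DecidableEq m] [Fintype n]
    [DecidableEq n] {W : Matrix m m ℂ} (hW : W ∈ unitaryGroup m ℂ) (X : Matrix m n ℂ) :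
    entropy (W * X * (W * X)ᴴ) = entropy (X * Xᴴ) := by
  have hW' : Wᴴ * W = 1 := mem_unitaryGroup_iff'.1 hW
  rw [entropy_mul_conjTranspose, entropy_mul_conjTranspose, conjTranspose_mul, Matrix.mul_assoc,
    ← Matrix.mul_assoc Wᴴ, hW', Matrix.one_mul]

theorem hsSq_cutA (Ψ : Matrix (A × Fin q) F ℂ) : hsSq (cutA Ψ) = hsSq Ψ := by
  simp only [hsSq, cutA, of_apply, Fintype.sum_prod_type]
  rw [Finset.sum_comm_cycle]
  exact Finset.sum_congr rfl fun _ _ => Finset.sum_comm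

theorem hsSq_cutD {E : Type*} [Fintype E] (Ψ : Matrix E (Fin q × D) ℂ) :
    hsSq (cutD Ψ) = hsSq Ψ := by
  simp only [hsSq, cutD, of_apply, Fintype.sum_prod_type]

theorem hsSq_swapTranspose {E : Type*} [Fintype E] (Ψ : Matrix E (Fin q × D) ℂ) :
    hsSq (swapTranspose Ψ) = hsSq Ψ := by
  simp only [hsSq, swapTranspose, of_apply, Fintype.sum_prod_type]
  rw [Finset.sum_comm_cycle]
  refine Finset.sum_congr rfl fun _ _ => Finset.sum_comm

theorem trace_gram {m n : Type*} [Fintype m] [Fintype n] {X : Matrix m n ℂ} (h : hsSq X = 1) :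
    (X * Xᴴ).trace = 1 := by
  rw [trace_mul_conjTranspose_self, h, Complex.ofReal_one]

/-- With `ε = 2 ln q + S(AB) - S(AB')`, both `ε = [ln q + S(AB) - S(A)] + [ln q + S(A) - S(AB')]`
and `ε = [ln q + S(AB) - S(D)] + [ln q + S(D) - S(AB')]`. All four brackets are relative entropies,
hence nonnegative, so each is at most `ε`; the first three are the ones needed later. -/
theorem entropy_defects_le [DecidableEq A] [DecidableEq D] (hq : 0 < q)
    {u : Matrix (Fin q × Fin q) (Fin q × Fin q) ℂ} (hu : u ∈ unitaryGroup (Fin q × Fin q) ℂ)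
    {Ψ : Matrix (A × Fin q) (Fin q × D) ℂ} (hΨ : hsSq Ψ = 1) {ε : ℝ}
    (hε : entropy (applyGateMatrix u Ψ * (applyGateMatrix u Ψ)ᴴ) - entropy (Ψ * Ψᴴ)
      = 2 * Real.log q - ε) :
    Real.log q + entropy (partialTraceRight (cutA Ψ * (cutA Ψ)ᴴ)) - entropy (cutA Ψ * (cutA Ψ)ᴴ)
        ≤ ε ∧
    Real.log q + entropy (partialTraceRight (cutD Ψ * (cutD Ψ)ᴴ)) - entropy (cutD Ψ * (cutD Ψ)ᴴ)
        ≤ ε ∧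
    Real.log q + entropy (partialTraceRight (applyGateMatrix u Ψ * (applyGateMatrix u Ψ)ᴴ))
        - entropy (applyGateMatrix u Ψ * (applyGateMatrix u Ψ)ᴴ) ≤ ε := by
  set Φ := applyGateMatrix u Ψ with hΦ
  have hΦ1 : hsSq Φ = 1 := by
    rw [← hsSq_cutD, hΦ, cutD_applyGateMatrix, hsSq_unitary_mul (gateOnLeft_mem_unitaryGroup hu),
      hsSq_cutD, hΨ]
  have hA := conditional_entropy_defect_nonneg hq
    (posSemidef_self_mul_conjTranspose (cutA Ψ)) (trace_gram ((hsSq_cutA Ψ).trans hΨ))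
  have hD := conditional_entropy_defect_nonneg hq
    (posSemidef_self_mul_conjTranspose (cutD Ψ)) (trace_gram ((hsSq_cutD Ψ).trans hΨ))
  have hA' := conditional_entropy_defect_nonneg hq
    (posSemidef_self_mul_conjTranspose Φ) (trace_gram hΦ1)
  have hD' := conditional_entropy_defect_nonneg hq
    (posSemidef_self_mul_conjTranspose (swapTranspose Φ))
    (trace_gram ((hsSq_swapTranspose Φ).trans hΦ1))
  have eA : entropy (cutA Φ * (cutA Φ)ᴴ) = entropy (cutA Ψ * (cutA Ψ)ᴴ) := by
    rw [hΦ, cutA_applyGateMatrix, entropy_unitary_mul (gateOnRight_mem_unitaryGroup hu)]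
  have eD : entropy (cutD Φ * (cutD Φ)ᴴ) = entropy (cutD Ψ * (cutD Ψ)ᴴ) := by
    rw [hΦ, cutD_applyGateMatrix, entropy_unitary_mul (gateOnLeft_mem_unitaryGroup hu)]
  have eS : entropy (swapTranspose Φ * (swapTranspose Φ)ᴴ) = entropy (Φ * Φᴴ) := by
    rw [← swapTranspose_transpose_mul, entropy_transpose_mul]
  rw [partialTraceRight_cutA, entropy_transpose_mul] at hA ⊢
  rw [partialTraceRight_cutD] at hD ⊢
  rw [partialTraceRight_mul_conjTranspose, entropy_transpose_mul, eA] at hA' ⊢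
  rw [partialTraceRight_swapTranspose, entropy_transpose_mul, eD, eS] at hD'
  refine ⟨?_, ?_, ?_⟩ <;> linarith

/-! ### Replacing the purifying system -/

/-- The inverse of `cutA`. If `R` is a square root of the state on `F ⊗ B`, then `ofCutA R` is a
purification of that state whose purifying system is a copy of `F ⊗ B`. -/
def ofCutA {A F : Type*} (R : Matrix (F × Fin q) A ℂ) : Matrix (A × Fin q) F ℂ :=
  of fun x f => R (f, x.2) x.1

/-- The entropy of `AB` depends only on the reduced state of the complement of `A`, so that the
purifying system `A` may be replaced. -/
theorem entropy_eq_of_cutA_gram_eq {A' : Type*} [Fintype A'] [DecidableEq A] [DecidableEq A']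
    [DecidableEq F] {Ψ : Matrix (A × Fin q) F ℂ} {Ψ' : Matrix (A' × Fin q) F ℂ}
    (h : cutA Ψ * (cutA Ψ)ᴴ = cutA Ψ' * (cutA Ψ')ᴴ) : entropy (Ψ * Ψᴴ) = entropy (Ψ' * Ψ'ᴴ) := by
  rw [← entropy_transpose_mul, ← partialTraceRight_cutA, h, partialTraceRight_cutA,
    entropy_transpose_mul]

theorem entropy_applyGateMatrix_eq_of_cutA_gram_eq {A' : Type*} [Fintype A'] [DecidableEq A]
    [DecidableEq A'] [DecidableEq D] (u : Matrix (Fin q × Fin q) (Fin q × Fin q) ℂ)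
    {Ψ : Matrix (A × Fin q) (Fin q × D) ℂ} {Ψ' : Matrix (A' × Fin q) (Fin q × D) ℂ}
    (h : cutA Ψ * (cutA Ψ)ᴴ = cutA Ψ' * (cutA Ψ')ᴴ) :
    entropy (applyGateMatrix u Ψ * (applyGateMatrix u Ψ)ᴴ)
      = entropy (applyGateMatrix u Ψ' * (applyGateMatrix u Ψ')ᴴ) := by
  apply entropy_eq_of_cutA_gram_eq
  rw [cutA_applyGateMatrix, cutA_applyGateMatrix, conjTranspose_mul, conjTranspose_mul,
    Matrix.mul_assoc, ← Matrix.mul_assoc (cutA Ψ), h]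
  simp only [Matrix.mul_assoc]

theorem entanglementEntropy_eq_entropy {l r : Type*} [Fintype l] [DecidableEq l] [Fintype r]
    (ψ : EuclideanSpace ℂ (l × r)) :
    entanglementEntropy ψ
      = entropy ((of fun x y => ψ (x, y) : Matrix l r ℂ) * (of fun x y => ψ (x, y))ᴴ) := by
  rw [entanglementEntropy, vonNeumannEntropy_eq_entropy]
  congr 1

/-! ### Choi states -/

/-- The partial trace over `E` of an operator on `(E ⊗ X) ⊗ Y`. -/
def traceEnv {E X Y : Type*} [Fintype E] (ρ : Matrix ((E × X) × Y) ((E × X) × Y) ℂ) :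
    Matrix (X × Y) (X × Y) ℂ :=
  of fun x y => ∑ e, ρ ((e, x.1), x.2) ((e, y.1), y.2)

theorem trace_gateOnLeft_mul {E : Type*} [Fintype E] [DecidableEq E]
    (W : Matrix (Fin q × Fin q) (Fin q × Fin q) ℂ)
    (ρ : Matrix ((E × Fin q) × Fin q) ((E × Fin q) × Fin q) ℂ) :
    (gateOnLeft E W * ρ).trace = (W * traceEnv ρ).trace := by
  simp only [trace, diag_apply, Fintype.sum_prod_type, gateOnLeft_mul_apply]
  simp only [mul_apply, traceEnv, of_apply, Fintype.sum_prod_type, Finset.mul_sum]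
  rw [Finset.sum_comm]
  refine Finset.sum_congr rfl fun k _ => ?_
  rw [Finset.sum_comm]
  refine Finset.sum_congr rfl fun i _ => ?_
  rw [Finset.sum_comm]
  refine Finset.sum_congr rfl fun b _ => ?_
  exact Finset.sum_comm

theorem trace_kronecker_one_mul {m n : Type*} [Fintype m] [Fintype n] [DecidableEq n]
    (Y : Matrix m m ℂ) (ρ : Matrix (m × n) (m × n) ℂ) :
    ((Y ⊗ₖ (1 : Matrix n n ℂ)) * ρ).trace = (Y * partialTraceRight ρ).trace := by
  classical
  have h := partialTraceRight_kronecker_mul_mul Y 1 ρ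
  rw [one_kronecker_one, mul_one, mul_one] at h
  rw [← h, trace_partialTraceRight]

/-- Take `R` as a pure state of `(F ⊗ B) ⊗ (E ⊗ B̃)`, adjoin a maximally mixed qudit `C`, purified
by one more qudit, and apply `u` to `B ⊗ C`. The result is arranged with rows `B̃ × B'` and with
all other systems as columns: `E`, then `F` and the purification of `C`, then `C'`. If `B` and `B̃`
are maximally entangled, its reduced state on `B̃ ⊗ B'` is `q⁻² T_u`; see
`choiVector_product_gram`. -/
def choiVector {E F : Type*} [Fintype E] [DecidableEq E] [Fintype F]
    (u : Matrix (Fin q × Fin q) (Fin q × Fin q) ℂ) (R : Matrix (F × Fin q) (E × Fin q) ℂ) :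
    Matrix (Fin q × Fin q) (E × (F × Fin q) × Fin q) ℂ :=
  of fun x y => (gateOnLeft (E × Fin q) u *
    (((√q)⁻¹ : ℂ) • ofCutA R ⊗ₖ (1 : Matrix (Fin q) (Fin q) ℂ)))
      (((y.1, x.1), x.2), y.2.2) y.2.1

section Choi

variable {E : Type*} [Fintype E] [DecidableEq E]
  (u : Matrix (Fin q × Fin q) (Fin q × Fin q) ℂ) (R : Matrix (F × Fin q) (E × Fin q) ℂ)

theorem choiVector_apply (k i : Fin q) (e : E) (f : F) (l j : Fin q) :
    choiVector u R (k, i) (e, (f, l), j)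
      = (√q : ℂ)⁻¹ * ∑ b, u (i, j) (b, l) * R (f, b) (e, k) := by
  rw [choiVector, of_apply, gateOnLeft_mul_apply]
  simp only [Matrix.smul_apply, kroneckerMap_apply, ofCutA, of_apply, one_apply, smul_eq_mul,
    mul_ite, mul_one, mul_zero, Finset.sum_ite_eq', Finset.mem_univ, if_true, Finset.mul_sum]
  exact Finset.sum_congr rfl fun b _ => by ring

theorem choiVector_mul_conjTranspose :
    choiVector u R * (choiVector u R)ᴴ
      = traceEnv (partialTraceRight (gateOnLeft (E × Fin q) u *
          ((ofCutA R * (ofCutA R)ᴴ) ⊗ₖ maximallyMixed q) * (gateOnLeft (E × Fin q) u)ᴴ)) := by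
  rw [← smul_kronecker_one_mul_conjTranspose, ← Matrix.mul_assoc, Matrix.mul_assoc _ _ᴴ,
    ← conjTranspose_mul]
  ext ⟨k, i⟩ ⟨k', i'⟩
  rw [mul_apply]
  simp only [traceEnv, of_apply, partialTraceRight, choiVector, conjTranspose_apply]
  rw [Fintype.sum_prod_type]
  refine Finset.sum_congr rfl fun e _ => ?_
  rw [Fintype.sum_prod_type, Finset.sum_comm]
  refine Finset.sum_congr rfl fun j _ => ?_
  rw [mul_apply]
  rfl

theorem hsSq_choiVector (hq : 0 < q) {u : Matrix (Fin q × Fin q) (Fin q × Fin q) ℂ}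
    (hu : u ∈ unitaryGroup (Fin q × Fin q) ℂ) : hsSq (choiVector u R) = hsSq R := by
  have h1 : hsSq (ofCutA R) = hsSq R := (hsSq_cutA (ofCutA R)).symm
  rw [← h1, ← hsSq_smul_kronecker_one hq (ofCutA R),
    ← hsSq_unitary_mul (gateOnLeft_mem_unitaryGroup hu)]
  simp only [hsSq, choiVector, of_apply]
  simp only [Fintype.sum_prod_type (α₁ := (E × Fin q) × Fin q) (α₂ := Fin q),
    Fintype.sum_prod_type (α₁ := E × Fin q) (α₂ := Fin q),
    Fintype.sum_prod_type (α₁ := E) (α₂ := Fin q),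
    Fintype.sum_prod_type (α₁ := Fin q) (α₂ := Fin q),
    Fintype.sum_prod_type (α₁ := E) (α₂ := (F × Fin q) × Fin q),
    Fintype.sum_prod_type (α₁ := F × Fin q) (α₂ := Fin q)]
  rw [Finset.sum_comm_cycle]
  refine Finset.sum_congr rfl fun e _ => Finset.sum_congr rfl fun k _ =>
    Finset.sum_congr rfl fun i _ => Finset.sum_comm

theorem choiVector_sub (R' : Matrix (F × Fin q) (E × Fin q) ℂ) :
    choiVector u (R - R') = choiVector u R - choiVector u R' := by
  ext ⟨k, i⟩ ⟨e, ⟨f, l⟩, j⟩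
  simp only [Matrix.sub_apply, choiVector_apply, mul_sub, Finset.sum_sub_distrib]

end Choi

theorem choiVector_product_gram [DecidableEq F]
    (u : Matrix (Fin q × Fin q) (Fin q × Fin q) ℂ)
    {S : Matrix F F ℂ} (hS : hsSq S = 1) :
    choiVector u (((√q)⁻¹ : ℂ) • S ⊗ₖ (1 : Matrix (Fin q) (Fin q) ℂ))
        * (choiVector u (((√q)⁻¹ : ℂ) • S ⊗ₖ (1 : Matrix (Fin q) (Fin q) ℂ)))ᴴ
      = ((q : ℂ) ^ 2)⁻¹ • dualContraction u := by
  have hv : ∀ (k i : Fin q) (e f : F) (l j : Fin q),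
      choiVector u (((√q)⁻¹ : ℂ) • S ⊗ₖ (1 : Matrix (Fin q) (Fin q) ℂ)) (k, i) (e, (f, l), j)
        = (q : ℂ)⁻¹ * S f e * u (i, j) (k, l) := by
    intro k i e f l j
    rw [choiVector_apply]
    simp only [Matrix.smul_apply, kroneckerMap_apply, one_apply, smul_eq_mul, mul_ite, mul_one,
      mul_zero, Finset.sum_ite_eq', Finset.mem_univ, if_true]
    have h : (q : ℂ)⁻¹ = (√q : ℂ)⁻¹ * (√q : ℂ)⁻¹ := by
      rw [← mul_inv, ← Complex.ofReal_mul, Real.mul_self_sqrt (Nat.cast_nonneg q),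
        Complex.ofReal_natCast]
    rw [h]
    ring
  have hS' : ∑ e, ∑ f, S f e * star (S f e) = 1 := by
    have h := trace_gram hS
    rw [trace, Finset.sum_congr rfl fun _ _ => by rw [diag_apply, mul_apply], Finset.sum_comm] at h
    exact h
  ext ⟨k, i⟩ ⟨k', i'⟩
  rw [mul_apply]
  simp only [conjTranspose_apply, Fintype.sum_prod_type, hv, Matrix.smul_apply, dualContraction,
    of_apply, smul_eq_mul]
  calc _ = ∑ e, ∑ f, (S f e * star (S f e)) * (((q : ℂ) ^ 2)⁻¹ *
        ∑ j, ∑ l, u (i, j) (k, l) * star (u (i', j) (k', l))) := by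
        refine Finset.sum_congr rfl fun e _ => Finset.sum_congr rfl fun f _ => ?_
        rw [Finset.sum_comm]
        simp only [Finset.mul_sum]
        refine Finset.sum_congr rfl fun j _ => Finset.sum_congr rfl fun l _ => ?_
        simp only [star_mul', star_inv₀, star_natCast]
        ring
    _ = _ := by
        simp only [← Finset.sum_mul, hS', one_mul]

/-- If the state `R` is close to one in which `B` is maximally entangled with its copy, the reduced
state of `choiVector u R` is close to `q⁻² T_u`. -/
theorem norm_trace_choiVector_sub_le [DecidableEq F] (hq : 0 < q)
    {u : Matrix (Fin q × Fin q) (Fin q × Fin q) ℂ} (hu : u ∈ unitaryGroup (Fin q × Fin q) ℂ)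
    {R : Matrix (F × Fin q) (F × Fin q) ℂ} (hR : hsSq R = 1) {S : Matrix F F ℂ} (hS : hsSq S = 1)
    {W : Matrix (Fin q × Fin q) (Fin q × Fin q) ℂ} (hW : W ∈ unitaryGroup (Fin q × Fin q) ℂ) :
    ‖(W * (choiVector u R * (choiVector u R)ᴴ)).trace
        - (W * (((q : ℂ) ^ 2)⁻¹ • dualContraction u)).trace‖
      ≤ 2 * √(hsSq (R - ((√q)⁻¹ : ℂ) • S ⊗ₖ (1 : Matrix (Fin q) (Fin q) ℂ))) := by
  rw [← choiVector_product_gram u hS, ← hsSq_choiVector _ hq hu, choiVector_sub]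
  refine norm_trace_unitary_sub_le hW ?_ ?_
  · rw [hsSq_choiVector _ hq hu, hR]
  · rw [hsSq_choiVector _ hq hu, hsSq_smul_kronecker_one hq, hS]

/-! ### Approximate dual unitarity -/

/-- The gate exchanging the two qudits, which is dual unitary. -/
def swapGate (q : ℕ) : Matrix (Fin q × Fin q) (Fin q × Fin q) ℂ :=
  (1 : Matrix (Fin q × Fin q) (Fin q × Fin q) ℂ).submatrix id Prod.swap

theorem swapGate_apply (i j b l : Fin q) :
    swapGate q (i, j) (b, l) = if i = l then if j = b then 1 else 0 else 0 := by
  simp [swapGate, one_apply, ite_and]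

theorem swapGate_mem_unitaryGroup : swapGate q ∈ unitaryGroup (Fin q × Fin q) ℂ := by
  rw [mem_unitaryGroup_iff]
  ext ⟨i, j⟩ ⟨i', j'⟩
  simp [mul_apply, Fintype.sum_prod_type, swapGate_apply, one_apply, star_apply, ite_and]
  aesop

theorem dualContraction_swapGate : dualContraction (swapGate q) = 1 := by
  ext ⟨k, i⟩ ⟨k', i'⟩
  simp [dualContraction, swapGate_apply, one_apply, ite_and]
  aesop

/-- For the swap, the qudit `B'` is the adjoined maximally mixed one, so the reduced state of
`choiVector` on `B̃ ⊗ B'` is a product with `1 / q`. -/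
theorem choiVector_swapGate_gram {E : Type*} [Fintype E] [DecidableEq E]
    (R : Matrix (F × Fin q) (E × Fin q) ℂ) :
    choiVector (swapGate q) R * (choiVector (swapGate q) R)ᴴ
      = traceEnv ((Rᵀ * Rᵀᴴ) ⊗ₖ maximallyMixed q) := by
  have hv : ∀ (k i : Fin q) (e : E) (f : F) (l j : Fin q),
      choiVector (swapGate q) R (k, i) (e, (f, l), j)
        = if i = l then (√q : ℂ)⁻¹ * R (f, j) (e, k) else 0 := by
    intro k i e f l j
    rw [choiVector_apply]
    simp only [swapGate_apply]
    split_ifs <;> simp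
  have h : (q : ℂ)⁻¹ = (√q : ℂ)⁻¹ * (√q : ℂ)⁻¹ := by
    rw [← mul_inv, ← Complex.ofReal_mul, Real.mul_self_sqrt (Nat.cast_nonneg q),
      Complex.ofReal_natCast]
  ext ⟨k, i⟩ ⟨k', i'⟩
  rw [mul_apply]
  simp only [conjTranspose_apply, Fintype.sum_prod_type, hv, traceEnv, of_apply,
    kroneckerMap_apply, maximallyMixed, Matrix.smul_apply, one_apply, smul_eq_mul, mul_apply,
    transpose_apply, Finset.sum_mul]
  refine Finset.sum_congr rfl fun e _ => Finset.sum_congr rfl fun f _ => ?_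
  rw [Finset.sum_comm]
  refine Finset.sum_congr rfl fun j _ => ?_
  rcases eq_or_ne i i' with rfl | hne
  · simp [h]
    ring
  · simp [hne, apply_ite star]

theorem dualContraction_isHermitian (u : Matrix (Fin q × Fin q) (Fin q × Fin q) ℂ) :
    (dualContraction u).IsHermitian := by
  ext x y
  simp [dualContraction, conjTranspose_apply, mul_comm]

theorem maximallyMixed_kronecker_maximallyMixed :
    maximallyMixed q ⊗ₖ maximallyMixed q
      = ((q : ℂ) ^ 2)⁻¹ • (1 : Matrix (Fin q × Fin q) (Fin q × Fin q) ℂ) := by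
  rw [maximallyMixed, smul_kronecker, kronecker_smul, one_kronecker_one, smul_smul, ← mul_inv, sq]

/-- The bound for states whose system `A` is a copy `(C ⊗ D) ⊗ B̃` of the complement
`(C ⊗ D) ⊗ B`. -/
theorem traceNorm_le_of_canonical [DecidableEq D] (hq : 0 < q)
    {u : Matrix (Fin q × Fin q) (Fin q × Fin q) ℂ} (hu : u ∈ unitaryGroup (Fin q × Fin q) ℂ)
    {R : Matrix ((Fin q × D) × Fin q) ((Fin q × D) × Fin q) ℂ} (hR : hsSq R = 1)
    {S : Matrix (Fin q × D) (Fin q × D) ℂ} (hS : hsSq S = 1) {ε : ℝ}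
    (hRS : hsSq (R - ((√q)⁻¹ : ℂ) • S ⊗ₖ (1 : Matrix (Fin q) (Fin q) ℂ)) ≤ ε)
    (hε : entropy (applyGateMatrix u (ofCutA R) * (applyGateMatrix u (ofCutA R))ᴴ)
      - entropy (ofCutA R * (ofCutA R)ᴴ) = 2 * Real.log q - ε) :
    traceNorm (maximallyMixed q ⊗ₖ maximallyMixed q - ((q : ℂ) ^ 2)⁻¹ • dualContraction u)
      ≤ 8 * √ε := by
  have hΨ : hsSq (ofCutA R) = 1 := (hsSq_cutA (ofCutA R)).symm.trans hR
  obtain ⟨-, hD, hA⟩ := entropy_defects_le hq hu hΨ hε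
  set Ψ := ofCutA R with hΨdef
  set Φ := applyGateMatrix u Ψ with hΦ
  have hΦ1 : hsSq Φ = 1 := by
    rw [← hsSq_cutD, hΦ, cutD_applyGateMatrix, hsSq_unitary_mul (gateOnLeft_mem_unitaryGroup hu),
      hsSq_cutD, hΨ]
  have hX : (maximallyMixed q ⊗ₖ maximallyMixed q
      - ((q : ℂ) ^ 2)⁻¹ • dualContraction u).IsHermitian := by
    have h0 : star (((q : ℂ) ^ 2)⁻¹) = ((q : ℂ) ^ 2)⁻¹ := by simp
    rw [maximallyMixed_kronecker_maximallyMixed, IsHermitian, conjTranspose_sub,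
      conjTranspose_smul, conjTranspose_smul, (dualContraction_isHermitian u).eq,
      conjTranspose_one, h0]
  obtain ⟨W, hW, hWX⟩ := exists_unitary_trace_mul_eq_traceNorm hX
  have hU := gateOnLeft_mem_unitaryGroup (A := (Fin q × D) × Fin q) hu
  set U := gateOnLeft ((Fin q × D) × Fin q) u with hUdef
  have hY := gateOnLeft_mem_unitaryGroup (A := Fin q × D) hW
  set Y := gateOnLeft (Fin q × D) W with hYdef
  have hY1 : Y ⊗ₖ (1 : Matrix (Fin q) (Fin q) ℂ) ∈ unitaryGroup _ ℂ :=
    kronecker_mem_unitary hY (one_mem _)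
  have hsqrt : ∀ {d : ℝ}, d ≤ ε → 2 * √d ≤ 2 * √ε := fun hd => by gcongr
  -- Four comparisons of reduced states on `B̃ ⊗ B'`, each costing `2 √ε`:
  -- `q⁻² T_u` with `choiVector u`, `q⁻² 1 = q⁻² T_swap` with `choiVector swapGate`, the true state
  -- with `ρ_B̃ ⊗ 1 / q`, and the true state with the one in which `C` is decoupled from `A ⊗ B`.
  have h1 := (norm_trace_choiVector_sub_le hq hu hR hS hW).trans (hsqrt hRS)
  have h2 := (norm_trace_choiVector_sub_le hq swapGate_mem_unitaryGroup hR hS hW).trans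
    (hsqrt hRS)
  have h3 := (norm_trace_sub_kronecker_maximallyMixed_le hq
    (posSemidef_self_mul_conjTranspose Φ) (trace_gram hΦ1) hY).trans (hsqrt hA)
  have h4 := (norm_trace_sub_kronecker_maximallyMixed_le hq
    (posSemidef_self_mul_conjTranspose (cutD Ψ)) (trace_gram ((hsSq_cutD Ψ).trans hΨ))
    (mul_mem (mul_mem (Unitary.star_mem hU) hY1) hU)).trans (hsqrt hD)
  have conj : ∀ ρ, (star U * Y ⊗ₖ (1 : Matrix (Fin q) (Fin q) ℂ) * U * ρ).trace
      = (W * traceEnv (partialTraceRight (U * ρ * Uᴴ))).trace := by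
    intro ρ
    rw [← trace_gateOnLeft_mul, ← trace_kronecker_one_mul, mul_assoc, mul_assoc, trace_mul_comm,
      star_eq_conjTranspose, mul_assoc]
  have hcutD : U * (cutD Ψ * (cutD Ψ)ᴴ) * Uᴴ = cutD Φ * (cutD Φ)ᴴ := by
    rw [hΦ, cutD_applyGateMatrix, conjTranspose_mul]
    simp only [Matrix.mul_assoc]
    rfl
  have hcutA : (cutA Φ)ᵀ * (cutA Φ)ᵀᴴ = Rᵀ * Rᵀᴴ := by
    have hG : (gateOnRight D u)ᴴ * gateOnRight D u = 1 :=
      mem_unitaryGroup_iff'.1 (gateOnRight_mem_unitaryGroup hu)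
    have hgram : ∀ Z : Matrix ((Fin q × D) × Fin q) ((Fin q × D) × Fin q) ℂ,
        Zᵀ * Zᵀᴴ = (Zᴴ * Z)ᵀ := fun Z => by rw [transpose_mul]; rfl
    rw [hgram, hgram, hΦ, cutA_applyGateMatrix, conjTranspose_mul, mul_assoc,
      ← mul_assoc (gateOnRight D u)ᴴ, hG, one_mul]
    rfl
  -- The four comparisons chain from `q⁻² 1` through `ρ_B̃ ⊗ 1 / q`, the true state on `B̃ ⊗ B'`
  -- and the reduced state of `choiVector u` to `q⁻² T_u`.
  rw [conj, conj, hcutD, partialTraceRight_cutD, partialTraceRight_cutD, hUdef,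
    ← choiVector_mul_conjTranspose] at h4
  rw [trace_gateOnLeft_mul, trace_gateOnLeft_mul, partialTraceRight_mul_conjTranspose, hcutA,
    ← choiVector_swapGate_gram] at h3
  rw [dualContraction_swapGate, ← maximallyMixed_kronecker_maximallyMixed] at h2
  rw [Matrix.mul_sub, trace_sub] at hWX
  have hnn : ‖(traceNorm (maximallyMixed q ⊗ₖ maximallyMixed q
      - ((q : ℂ) ^ 2)⁻¹ • dualContraction u) : ℂ)‖ ≤ 8 * √ε := by
    rw [← hWX]
    rw [norm_sub_rev] at h2 h3
    refine ((norm_sub_le_norm_sub_add_norm_sub _ _ _).trans (add_le_add h2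
      ((norm_sub_le_norm_sub_add_norm_sub _ _ _).trans (add_le_add h3
        ((norm_sub_le_norm_sub_add_norm_sub _ _ _).trans (add_le_add h4 h1)))))).trans ?_
    linarith
  rw [Complex.norm_real] at hnn
  exact (le_abs_self _).trans hnn

end States

end DualUnitarity

end

theorem theorem1 :
    ∃ K : ℝ, 0 < K ∧
      ∀ (q dA dD : ℕ) (u : Matrix (Fin q × Fin q) (Fin q × Fin q) ℂ)
        (ψ : EuclideanSpace ℂ ((Fin dA × Fin q) × (Fin q × Fin dD))) (ε : ℝ),
        u ∈ Matrix.unitaryGroup (Fin q × Fin q) ℂ →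
        ‖ψ‖ = 1 →
        DualUnitarity.entanglementEntropy (DualUnitarity.applyGate u ψ)
            - DualUnitarity.entanglementEntropy ψ = 2 * Real.log q - ε →
        DualUnitarity.traceNorm
            (Matrix.kronecker (DualUnitarity.maximallyMixed q) (DualUnitarity.maximallyMixed q)
              - ((q : ℂ) ^ 2)⁻¹ • DualUnitarity.dualContraction u)
          ≤ K * Real.sqrt ε := by
  open DualUnitarity Matrix ComplexOrder in
  refine ⟨8, by norm_num, fun q dA dD u ψ ε hu hψ hε => ?_⟩
  set Ψ : Matrix (Fin dA × Fin q) (Fin q × Fin dD) ℂ := of fun x y => ψ (x, y) with hΨdef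
  have hΨ : hsSq Ψ = 1 := by
    have h := EuclideanSpace.norm_sq_eq ψ
    rw [hψ, one_pow, Fintype.sum_prod_type] at h
    exact h.symm
  -- For `q = 0` there are no unit vectors.
  have hq : 0 < q := by
    rcases Nat.eq_zero_or_pos q with rfl | h
    · simp [hsSq] at hΨ
    · exact h
  rw [entanglementEntropy_eq_entropy, entanglementEntropy_eq_entropy] at hε
  change entropy (applyGateMatrix u Ψ * (applyGateMatrix u Ψ)ᴴ) - entropy (Ψ * Ψᴴ) = _ at hε
  obtain ⟨hA, -, -⟩ := entropy_defects_le hq hu hΨ hε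
  have htr := trace_gram ((hsSq_cutA Ψ).trans hΨ)
  -- Replace `A` by a copy of its complement, with coefficient matrix the square root `R` of the
  -- reduced state; this leaves both entropies unchanged.
  obtain ⟨R, S, hR, hS, hRS⟩ := exists_sqrt_and_hsSq_le hq
    (posSemidef_self_mul_conjTranspose (cutA Ψ)) htr
  have hgram : cutA Ψ * (cutA Ψ)ᴴ = cutA (ofCutA R) * (cutA (ofCutA R))ᴴ := hR.symm
  rw [entropy_applyGateMatrix_eq_of_cutA_gram_eq u hgram, entropy_eq_of_cutA_gram_eq hgram] at hε
  exact traceNorm_le_of_canonical hq hu (hsSq_eq_one_of_trace (by rw [hR, htr]))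
    (hsSq_eq_one_of_trace (by rw [hS, trace_partialTraceRight, htr])) (hRS.trans hA) hε
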